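/- **Theorem (Recovery of eigenvectors from Chebyshev linearizations).** Let $\phi_j^{(1)}=T_j$ and $\phi_j^{(2)}=U_j$ be the Chebyshev polynomials of the first and second kind. Let $r\in\{1,2\}$, let $k\ge 1$ and $0\le\epsilon\le k-1$ be integers, and let $P(\lambda)=\sum_{i=0}^k P_i\,\phi_i^{(r)}(\lambda)$ with $P_i\in\mathbb C^{n\times n}$ be regular, i.e. $\det P(\lambda)\not\equiv 0$. For $i\in\{1,2\}$ and $s\ge 0$ let $K^{(i)}_s(\lambda)$ be the $sn\times(s+1)n$ pencil $$K^{(i)}_s(\lambda)=\begin{bmatrix} I_n&-2\lambda I_n&I_n\\ &\ddots&\ddots&\ddots\\ &&I_n&-2\lambda I_n&I_n\\ &&&I_n&-\phi_1^{(i)}(\lambda)I_n\end{bmatrix},$$ and put $K_1=K_\epsilon^{(r)}$, $K_2=K_{k-1-\epsilon}^{(2)}$. Let $M(\lambda)$ be the following $(k-\epsilon)\times(\epsilon+1)$ block matrix with $n\times n$ blocks. * If $1\le\epsilon\le k-2$: the first block column is $2\lambda P_k+P_{k-1},\ P_{k-2}-P_k,\ P_{k-3},\dots,P_\epsilon$;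 the second block column is $-P_k,-P_{k-1},\dots,-P_{\epsilon+2},\ P_{\epsilon-1}-P_{\epsilon+1}$; the last block row continues, from its third block on, with $P_{\epsilon-2},\dots,P_0$; all other blocks are $0$. * If $\epsilon=k-1\ge 1$: $M=[\,2\lambda P_k+P_{k-1}\;\; P_{k-2}-P_k\;\; P_{k-3}\;\cdots\;P_0\,]$. * If $\epsilon=0$ and $r=2$: $M$ is the block column with blocks $2\lambda P_k+P_{k-1},\ P_{k-2}-P_k,\ P_{k-3},\dots,P_0$. * If $\epsilon=0$ and $r=1$: $M$ is $\tfrac12$ times the block column with blocks $2\lambda P_k+P_{k-1},\ P_{k-2}-2P_k,\ P_{k-3}-P_{k-1},\dots,P_1-P_3,\ 2P_0-P_2$; for $k=2$ this column is understood as $2\lambda P_2+P_1,\ 2P_0-2P_2$, and for $k=1$ as the single block $2\lambda P_1+2P_0$. Let $A$ and $B$ be arbitrary complex matrices of sizes $(k-\epsilon)n\times\epsilon n$ and $(k-1-\epsilon)n\times(\epsilon+1)n$, and let $$C(\lambda)=\begin{bmatrix} M(\lambda)+AK_1(\lambda)+K_2(\lambda)^TB & K_2(\lambda)^T\\ K_1(\lambda)&0\end{bmatrix}$$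 be the corresponding Chebyshev linearization of $P$. Vectors in $\mathbb C^{kn}$ are split into $k$ blocks of length $n$, and $v(i)$ denotes the $i$th block of $v$. A right (resp. left) eigenvector of a matrix polynomial $Q$ for a finite eigenvalue $\lambda_0\in\mathbb C$ is a vector $x\neq0$ with $Q(\lambda_0)x=0$ (resp. $y\ne0$ with $y^TQ(\lambda_0)=0$). If $Q$ is regarded with grade $g$ (that is, of degree at most $g$), its eigenvectors for the eigenvalue at infinity are the eigenvectors of $\mathrm{rev}_g Q(\lambda)=\lambda^gQ(1/\lambda)$ for the eigenvalue $0$; here $P$ has grade $k$ and $C$ has grade $1$. 1. If $z$ (resp. $w$) is a right (resp. left) eigenvector of $C(\lambda)$ for a finite eigenvalue $\lambda_0$, then $z(\epsilon+1)$ (resp. $w(k-\epsilon)$) is a right (resp. left) eigenvector of $P(\lambda)$ for $\lambda_0$. 2. If $z$ (resp. $w$) is a right (resp. left) eigenvector of $C(\lambda)$ for the eigenvalue at infinity, then $z(1)$ (resp. $w(1)$) is a right (resp. left) eigenvector of $P(\lambda)$ for the eigenvalue at infinity. -/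

import Mathlib

namespace ChebLin

open Polynomial

/-- The two kinds of Chebyshev bases. -/
inductive Kind
  | first
  | second

/-- `phi r j` is the `j`-th Chebyshev polynomial of the `r`-th kind. -/
noncomputable def phi : Kind → ℕ → ℂ[X]
  | Kind.first, j => Chebyshev.T ℂ (j : ℤ)
  | Kind.second, j => Chebyshev.U ℂ (j : ℤ)

/-- A constant complex matrix seen as a matrix polynomial. -/
noncomputable def const {α β : Type} (A : Matrix α β ℂ) : Matrix α β ℂ[X] :=
  A.map Polynomial.C

/-- The matrix polynomial `∑_{i=0}^k P_i φ_i^{(r)}(λ)`; only `P 0, …, P k` are used. -/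
noncomputable def matPoly {n : ℕ} (r : Kind) (k : ℕ) (P : ℕ → Matrix (Fin n) (Fin n) ℂ) :
    Matrix (Fin n) (Fin n) ℂ[X] :=
  ∑ i ∈ Finset.range (k + 1), phi r i • const (P i)

/-- A square matrix polynomial is regular if its determinant is not identically zero. -/
def IsRegular {n : ℕ} (Q : Matrix (Fin n) (Fin n) ℂ[X]) : Prop :=
  Q.det ≠ 0

/-- The value of a matrix polynomial at a complex number. -/
noncomputable def evalAt {α β : Type} (Q : Matrix α β ℂ[X]) (z : ℂ) : Matrix α β ℂ :=
  Q.map (Polynomial.eval z)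

/-- The `g`-reversal `λ^g Q(1/λ)` of a matrix polynomial of grade `g`: in each entry the
coefficients of `λ^i` and `λ^(g-i)` are exchanged. -/
noncomputable def rev {α β : Type} (g : ℕ) (Q : Matrix α β ℂ[X]) : Matrix α β ℂ[X] :=
  Q.map (Polynomial.reflect g)

/-- `x` is a right eigenvector of `Q` for the finite eigenvalue `z`. -/
def IsRightEigvec {α β : Type} [Fintype β] (Q : Matrix α β ℂ[X]) (z : ℂ) (x : β → ℂ) : Prop :=
  x ≠ 0 ∧ (evalAt Q z).mulVec x = 0

/-- `y` is a left eigenvector of `Q` for the finite eigenvalue `z`: `yᵀ Q(z) = 0`. -/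
def IsLeftEigvec {α β : Type} [Fintype α] (Q : Matrix α β ℂ[X]) (z : ℂ) (y : α → ℂ) : Prop :=
  y ≠ 0 ∧ Matrix.vecMul y (evalAt Q z) = 0

/-- `x` is a right eigenvector for the eigenvalue at infinity of `Q`, regarded with grade `g`. -/
def IsRightEigvecInf {α β : Type} [Fintype β] (g : ℕ) (Q : Matrix α β ℂ[X]) (x : β → ℂ) : Prop :=
  IsRightEigvec (rev g Q) 0 x

/-- `y` is a left eigenvector for the eigenvalue at infinity of `Q`, regarded with grade `g`. -/
def IsLeftEigvecInf {α β : Type} [Fintype α] (g : ℕ) (Q : Matrix α β ℂ[X]) (y : α → ℂ) : Prop :=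
  IsLeftEigvec (rev g Q) 0 y

/-- The matrix with given `n × n` blocks; its entries are indexed by
(block index, index inside the block). Block indices start at `0`. -/
def ofBlocks {n p q : ℕ} (F : ℕ → ℕ → Matrix (Fin n) (Fin n) ℂ[X]) :
    Matrix (Fin p × Fin n) (Fin q × Fin n) ℂ[X] :=
  Matrix.of fun a b => F a.1 b.1 a.2 b.2

/-- The banded pencil with `s` block rows and `s + 1` block columns whose block rows are
`[⋯ I, -2λI, I ⋯]`, except for the last one, which is `[⋯ I, -φ_1^{(r)}(λ) I]`. -/
noncomputable def K (n : ℕ) (r : Kind) (s : ℕ) :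
    Matrix (Fin s × Fin n) (Fin (s + 1) × Fin n) ℂ[X] :=
  ofBlocks fun a b =>
    if b = a then 1
    else if b = a + 1 then
      if a + 1 = s then (-phi r 1) • 1 else (-(2 * X : ℂ[X])) • 1
    else if b = a + 2 then 1
    else 0

section Body

variable {n : ℕ} (k : ℕ) (P : ℕ → Matrix (Fin n) (Fin n) ℂ)

/-- Block entry `b` of
`[2λP_k + P_{k-1}, P_{k-2} - P_k, P_{k-3}, …, P_1, P_0]`. -/
noncomputable def stripBlock (b : ℕ) : Matrix (Fin n) (Fin n) ℂ[X] :=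
  if b = 0 then (2 * X : ℂ[X]) • const (P k) + const (P (k - 1))
  else if b = 1 then const (P (k - 2)) - const (P k)
  else const (P (k - 1 - b))

/-- Block entry `a` of
`½ [2λP_k + P_{k-1}, P_{k-2} - 2P_k, P_{k-3} - P_{k-1}, …, P_1 - P_3, 2P_0 - P_2]`,
written so that it also makes sense when the first two entries overlap with the last one:
it is `½ [2λP_1 + 2P_0]` for `k = 1` and `½ [2λP_2 + P_1, 2P_0 - 2P_2]` for `k = 2`. -/
noncomputable def halfBlock (a : ℕ) : Matrix (Fin n) (Fin n) ℂ[X] :=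
  Polynomial.C (1 / 2 : ℂ) •
    ((if a = 0 then (2 * X : ℂ[X]) • const (P k)
      else if a = 1 then -((2 : ℂ[X]) • const (P k))
      else -const (P (k + 1 - a)))
    + (if a = k - 1 then (2 : ℂ[X]) • const (P 0) else const (P (k - 1 - a))))

/-- Block entry `(a, b)` of the `(k - ε) × (ε + 1)` block matrix whose first block column is
`2λP_k + P_{k-1}, P_{k-2} - P_k, P_{k-3}, …, P_ε`, whose second block column is
`-P_k, -P_{k-1}, …, -P_{ε+2}, P_{ε-1} - P_{ε+1}`, whose last block row continues with
`P_{ε-2}, …, P_0`, and whose other blocks are zero (`1 ≤ ε ≤ k - 2`). -/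
noncomputable def hookBlock (ε a b : ℕ) : Matrix (Fin n) (Fin n) ℂ[X] :=
  if b = 0 then stripBlock k P a
  else if b = 1 then
    if a = k - 1 - ε then const (P (ε - 1)) - const (P (ε + 1)) else -const (P (k - a))
  else if a = k - 1 - ε then const (P (ε - b))
  else 0

/-- The body of the colleague pencil, for `0 ≤ ε ≤ k - 1`;
`k - 1 - ε + 1 = k - ε` is its number of block rows. -/
noncomputable def body (ε : ℕ) : Kind →
    Matrix (Fin (k - 1 - ε + 1) × Fin n) (Fin (ε + 1) × Fin n) ℂ[X]
  | Kind.first =>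
    if ε = 0 then ofBlocks fun a _ => halfBlock k P a
    else if ε = k - 1 then ofBlocks fun _ b => stripBlock k P b
    else ofBlocks fun a b => hookBlock k P ε a b
  | Kind.second =>
    if ε = 0 then ofBlocks fun a _ => stripBlock k P a
    else if ε = k - 1 then ofBlocks fun _ b => stripBlock k P b
    else ofBlocks fun a b => hookBlock k P ε a b

/-- The Chebyshev linearization of `∑ P_i φ_i^{(r)}` with parameter `ε` and matrices `A`, `B`:
`[ M + A K₁ + K₂ᵀ B, K₂ᵀ ; K₁, 0 ]`, where `M` is the body of the colleague pencil. -/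
noncomputable def chebLinearization (r : Kind) (ε : ℕ)
    (A : Matrix (Fin (k - 1 - ε + 1) × Fin n) (Fin ε × Fin n) ℂ)
    (B : Matrix (Fin (k - 1 - ε) × Fin n) (Fin (ε + 1) × Fin n) ℂ) :
    Matrix ((Fin (k - 1 - ε + 1) × Fin n) ⊕ (Fin ε × Fin n))
      ((Fin (ε + 1) × Fin n) ⊕ (Fin (k - 1 - ε) × Fin n)) ℂ[X] :=
  Matrix.fromBlocks
    (body k P ε r + const A * K n r ε + (K n Kind.second (k - 1 - ε)).transpose * const B)
    (K n Kind.second (k - 1 - ε)).transpose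
    (K n r ε)
    0

end Body

/-- The block of index `a` (starting at `0`) in the upper part of a block vector that is
partitioned conformably with the pencil `chebLinearization`. -/
def blockEntry {n p : ℕ} {γ : Type} (v : (Fin p × Fin n) ⊕ γ → ℂ) (a : Fin p) : Fin n → ℂ :=
  fun i => v (Sum.inl (a, i))

end ChebLin

namespace ChebLin

open Polynomial

/-! The proof is a duality argument. The kernel of `K(z₀)` consists exactly of the vectors with
blocks `φ_s(z₀)x, …, φ_0(z₀)x` (`evalAt_K_mulVec_dualVec`, `eq_dualVec_of_evalAt_K_mulVec`), and the
body squeezed between such vectors for `K₂` and `K₁` gives back `P` (`sum_phi_smul_bodyBlock`). If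
`C(z₀)z = 0`, the bottom block row makes the upper part of `z` dual to `K₁`, with `x` its last
block. The top row then says that the body applied to it lies in the range of `K₂ᵀ`, whatever `A`
and `B` are. Pairing with dual vectors of `K₂` leaves `yᵀP(z₀)x = 0` for every `y`. If `x = 0`, the
upper part vanishes, and so does the lower part, since `K₂ᵀ` is injective
(`eq_zero_of_vecMul_evalAt_K`). At infinity the same block elimination is applied to the
coefficients of `λ`. That of `K` has zero first block column and is invertible on the others, so
only the first block of the upper part survives; the corner of the body acts on it as a nonzero
multiple of `P_k`. Left eigenvectors follow by exchanging the roles of `K₁` and `K₂`. -/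

/-! ### Chebyshev recurrences and degrees. -/

theorem phi_zero (r : Kind) : phi r 0 = 1 := by
  cases r <;> simp [phi]

theorem phi_add_two (r : Kind) (j : ℕ) :
    phi r (j + 2) = 2 * X * phi r (j + 1) - phi r j := by
  cases r
  · simp [phi, Chebyshev.T_add_two]
  · simp [phi, Chebyshev.U_add_two]

theorem phi_second_one : phi Kind.second 1 = 2 * X := by
  simp [phi]

theorem coeff_phi_self_ne_zero (r : Kind) (j : ℕ) : (phi r j).coeff j ≠ 0 := by
  cases r
  · have h : (Chebyshev.T ℂ (j : ℤ)).coeff j = 2 ^ (j - 1) := by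
      simpa [leadingCoeff, Chebyshev.natDegree_T] using Chebyshev.leadingCoeff_T ℂ (j : ℤ)
    simp [phi, h]
  · have h : (Chebyshev.U ℂ (j : ℤ)).coeff j = 2 ^ j := by
      simpa [leadingCoeff, Chebyshev.natDegree_U_natCast] using
        Chebyshev.leadingCoeff_U_natCast ℂ j
    simp [phi, h]

theorem natDegree_phi (r : Kind) (j : ℕ) : (phi r j).natDegree = j := by
  cases r
  · simp [phi, Chebyshev.natDegree_T]
  · simp [phi, Chebyshev.natDegree_U_natCast]

/-- The addition formula `φ_{m+1+j} = U_j φ_{m+1} - U_{j-1} φ_m`, with `j` shifted by one. -/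
theorem phi_add (r : Kind) (m j : ℕ) :
    phi r (m + 1 + (j + 1)) =
      phi Kind.second (j + 1) * phi r (m + 1) - phi Kind.second j * phi r m := by
  induction j using Nat.twoStepInduction with
  | zero => simp only [phi_add_two, phi_zero, phi_second_one, zero_add]; ring
  | one =>
    rw [show m + 1 + (1 + 1) = (m + 1) + 2 from rfl, phi_add_two r (m + 1),
      phi_add_two r m, phi_add_two _ 0, phi_zero, zero_add, phi_second_one]
    ring
  | more j h₀ h₁ =>
    rw [show m + 1 + (j + 2 + 1) = m + 1 + (j + 1) + 2 by ring, phi_add_two,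
      show m + 1 + (j + 1) + 1 = m + 1 + (j + 1 + 1) by ring, h₀, h₁,
      phi_add_two _ (j + 1), phi_add_two _ j]
    ring

/-! ### Kernels of scalar banded matrices. -/

section Band

/-- The scalar matrix whose Kronecker product with the identity is a value of the pencil `K`. -/
def band (s : ℕ) (α β γ : ℂ) : Matrix (Fin s) (Fin (s + 1)) ℂ :=
  Matrix.of fun a b =>
    if (b : ℕ) = a then α
    else if (b : ℕ) = a + 1 then if (a : ℕ) + 1 = s then γ else β
    else if (b : ℕ) = a + 2 then α else 0

variable {s : ℕ} {α β γ : ℂ}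

theorem sum_band_mul (g : ℕ → ℂ) (a : Fin s) :
    ∑ b, band s α β γ a b * g b =
      α * g a + if (a : ℕ) + 1 = s then γ * g (a + 1) else β * g (a + 1) + α * g (a + 2) := by
  have h : ∀ b : ℕ, (if b = a then α
      else if b = a + 1 then if (a : ℕ) + 1 = s then γ else β
      else if b = a + 2 then α else 0) * g b =
      (if b = (a : ℕ) then α * g b else 0) +
      (if b = a + 1 then (if (a : ℕ) + 1 = s then γ else β) * g b else 0) +
      (if b = a + 2 then α * g b else 0) := by
    intro b
    split_ifs <;> first | omega | simp
  have ha := a.2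
  simp only [band, Matrix.of_apply]
  rw [Fin.sum_univ_eq_sum_range (fun b : ℕ => (if b = a then α
      else if b = a + 1 then if (a : ℕ) + 1 = s then γ else β
      else if b = a + 2 then α else 0) * g b) (s + 1), Finset.sum_congr rfl fun b _ => h b,
    Finset.sum_add_distrib, Finset.sum_add_distrib]
  -- In the last row the index `a + 2 = s + 1` falls outside the range, so the third term drops out.
  simp only [Finset.sum_ite_eq', Finset.mem_range]
  rw [if_pos (by omega), if_pos (by omega)]
  split_ifs <;> first | omega | ring

/-- Read upwards, the last row fixes `g (s - 1)` from `g s`, and every other row is the Chebyshev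
recurrence. -/
theorem eq_phi_mul_of_band (r : Kind) (z : ℂ) (g : ℕ → ℂ)
    (h : ∀ a : Fin s, ∑ b, band s 1 (-(2 * z)) (-(phi r 1).eval z) a b * g b = 0) :
    ∀ j ≤ s, g (s - j) = (phi r j).eval z * g s := by
  intro j
  induction j using Nat.twoStepInduction with
  | zero => simp [phi_zero]
  | one =>
    intro hs
    have := h ⟨s - 1, by omega⟩
    rw [sum_band_mul, if_pos (by simp; omega)] at this
    simp only [Nat.sub_add_cancel hs] at this
    linear_combination this
  | more j h₀ h₁ =>
    intro hs
    have := h ⟨s - (j + 2), by omega⟩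
    rw [sum_band_mul, if_neg (by simp; omega)] at this
    simp only [show s - (j + 2) + 1 = s - (j + 1) by omega,
      show s - (j + 2) + 2 = s - j by omega] at this
    rw [h₀ (by omega), h₁ (by omega)] at this
    rw [phi_add_two]
    simp only [eval_sub, eval_mul, eval_X, eval_ofNat]
    linear_combination this

theorem sum_band_mul_phi (r : Kind) (z : ℂ) (a : Fin s) :
    ∑ b : Fin (s + 1), band s 1 (-(2 * z)) (-(phi r 1).eval z) a b *
      (phi r (s - b)).eval z = 0 := by
  have ha := a.2
  rw [sum_band_mul (fun b => (phi r (s - b)).eval z)]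
  split_ifs with h
  · simp [show s - (a : ℕ) = 1 by omega, show s - ((a : ℕ) + 1) = 0 by omega, phi_zero]
  · obtain ⟨j, hj⟩ : ∃ j, s = a + 2 + j := ⟨s - (a + 2), by omega⟩
    rw [show s - (a : ℕ) = j + 2 by omega, show s - ((a : ℕ) + 1) = j + 1 by omega,
      show s - ((a : ℕ) + 2) = j by omega, phi_add_two]
    simp only [eval_sub, eval_mul, eval_X, eval_ofNat]
    ring

/-- The first `s` columns form a unit upper triangular matrix, so forward substitution works for any
`β`, `γ`. -/
theorem eq_zero_of_sum_mul_band_one (u : Fin s → ℂ)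
    (h : ∀ b, ∑ a, u a * band s 1 β γ a b = 0) : u = 0 := by
  have key : ∀ m : ℕ, ∀ hm : m < s, u ⟨m, hm⟩ = 0 := by
    intro m
    induction m using Nat.strong_induction_on with
    | _ m ih =>
      intro hm
      have := h ⟨m, by omega⟩
      rw [Finset.sum_eq_single ⟨m, hm⟩] at this
      · simpa [band] using this
      · intro a _ ha
        rcases lt_trichotomy (a : ℕ) m with hlt | heq | hgt
        · have h0 : u a = 0 := ih a hlt a.2
          rw [h0, zero_mul]
        · exact absurd (Fin.ext heq) ha
        · have h0 : band s 1 β γ a ⟨m, by omega⟩ = 0 := by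
            simp only [band, Matrix.of_apply]
            rw [if_neg (by omega), if_neg (by omega), if_neg (by omega)]
          rw [h0, mul_zero]
      · simp
  ext a
  exact key a a.2

theorem band_zero_apply_succ (a a' : Fin s) :
    band s 0 β γ a a'.succ = if a = a' then if (a : ℕ) + 1 = s then γ else β else 0 := by
  by_cases h : a = a'
  · subst h; simp [band]
  · have h' : (a' : ℕ) ≠ a := fun e => h (Fin.ext e.symm)
    simp [band, h, h']

theorem band_zero_apply_zero (a : Fin s) : band s 0 β γ a 0 = 0 := by
  simp [band]

/-- With `α = 0` only the superdiagonal remains: a zero column followed by an invertible diagonal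
matrix. -/
theorem eq_zero_of_sum_mul_band_zero (hβ : β ≠ 0) (hγ : γ ≠ 0) (u : Fin s → ℂ)
    (h : ∀ b, ∑ a, u a * band s 0 β γ a b = 0) : u = 0 := by
  ext a
  have := h a.succ
  simp only [band_zero_apply_succ, mul_ite, mul_zero, Finset.sum_ite_eq', Finset.mem_univ,
    if_true] at this
  split_ifs at this <;> simpa [hβ, hγ] using this

theorem eq_zero_of_sum_band_zero_mul (hβ : β ≠ 0) (hγ : γ ≠ 0) (v : Fin (s + 1) → ℂ)
    (h : ∀ a, ∑ b, band s 0 β γ a b * v b = 0) (a : Fin s) : v a.succ = 0 := by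
  have := h a
  rw [Fin.sum_univ_succ] at this
  simp only [band_zero_apply_succ, band_zero_apply_zero, ite_mul, zero_mul, Finset.sum_ite_eq,
    Finset.mem_univ, if_true, zero_add] at this
  split_ifs at this <;> simpa [hβ, hγ] using this

end Band

/-! ### From scalar bands to the block pencil `K`. -/

section Kronecker

variable {n : ℕ} {p q : Type}

open scoped Kronecker

theorem kronecker_one_mulVec [Fintype q] (N : Matrix p q ℂ) (v : q × Fin n → ℂ) (a : p) (i : Fin n) :
    ((N ⊗ₖ (1 : Matrix (Fin n) (Fin n) ℂ)).mulVec v) (a, i) = ∑ b, N a b * v (b, i) := by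
  simp [Matrix.mulVec, dotProduct, Fintype.sum_prod_type, Matrix.one_apply]

theorem vecMul_kronecker_one [Fintype p] (N : Matrix p q ℂ) (u : p × Fin n → ℂ) (b : q) (i : Fin n) :
    (Matrix.vecMul u (N ⊗ₖ (1 : Matrix (Fin n) (Fin n) ℂ))) (b, i) = ∑ a, u (a, i) * N a b := by
  simp [Matrix.vecMul, dotProduct, Fintype.sum_prod_type, Matrix.one_apply]

theorem evalAt_K (r : Kind) (s : ℕ) (z : ℂ) :
    evalAt (K n r s) z = band s 1 (-(2 * z)) (-(phi r 1).eval z) ⊗ₖ 1 := by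
  ext ⟨a, i⟩ ⟨b, j⟩
  simp only [evalAt, K, ofBlocks, band, Matrix.map_apply, Matrix.of_apply,
    Matrix.kronecker_apply]
  by_cases hij : i = j
  · subst hij
    split_ifs <;> simp
  · split_ifs <;> simp [hij]

theorem map_coeff_one_K (r : Kind) (s : ℕ) :
    (K n r s).map (coeff · 1) = band s 0 (-2) (-(phi r 1).coeff 1) ⊗ₖ 1 := by
  ext ⟨a, i⟩ ⟨b, j⟩
  simp only [K, ofBlocks, band, Matrix.map_apply, Matrix.of_apply,
    Matrix.kronecker_apply]
  have h2 : (2 * X : ℂ[X]).coeff 1 = 2 := by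
    rw [← C_ofNat, coeff_C_mul, coeff_X_one, mul_one]
  by_cases hij : i = j
  · subst hij
    split_ifs <;> simp [coeff_one, h2]
  · split_ifs <;> simp [hij]

/-- The block vector with blocks `φ_{s}(z) x, …, φ_0(z) x`. -/
noncomputable def dualVec {n : ℕ} (r : Kind) (s : ℕ) (z : ℂ) (x : Fin n → ℂ) :
    Fin (s + 1) × Fin n → ℂ :=
  fun b => (phi r (s - b.1)).eval z * x b.2

theorem dualVec_zero (r : Kind) (s : ℕ) (z : ℂ) :
    dualVec r s z (0 : Fin n → ℂ) = 0 := by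
  ext b; simp [dualVec]

theorem evalAt_K_mulVec_dualVec (r : Kind) (s : ℕ) (z : ℂ) (x : Fin n → ℂ) :
    (evalAt (K n r s) z).mulVec (dualVec r s z x) = 0 := by
  ext ⟨a, i⟩
  rw [evalAt_K, kronecker_one_mulVec]
  simp only [dualVec, ← mul_assoc, ← Finset.sum_mul, sum_band_mul_phi, zero_mul, Pi.zero_apply]

theorem eq_dualVec_of_evalAt_K_mulVec (r : Kind) (s : ℕ) (z : ℂ)
    (v : Fin (s + 1) × Fin n → ℂ) (h : (evalAt (K n r s) z).mulVec v = 0) :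
    v = dualVec r s z fun i => v (Fin.last s, i) := by
  ext ⟨b, i⟩
  -- Extending one coordinate of the blocks to `ℕ` lets the recurrence run on plain indices; values
  -- beyond `s` play no role.
  let g : ℕ → ℂ := fun m => if hm : m < s + 1 then v (⟨m, hm⟩, i) else 0
  have hg : ∀ m : Fin (s + 1), g m = v (m, i) := fun m => dif_pos m.2
  have hband : ∀ a : Fin s, ∑ b, band s 1 (-(2 * z)) (-(phi r 1).eval z) a b * g b = 0 := by
    intro a
    have := congrFun h (a, i)
    rw [evalAt_K, kronecker_one_mulVec] at this
    simp only [hg]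
    exact this
  have hb := b.2
  have := eq_phi_mul_of_band r z g hband (s - b) (by omega)
  rw [show s - (s - (b : ℕ)) = b by omega, hg] at this
  rw [this]
  simp [dualVec, g, Fin.last]

theorem eq_zero_of_vecMul_evalAt_K (r : Kind) (s : ℕ) (z : ℂ) (u : Fin s × Fin n → ℂ)
    (h : Matrix.vecMul u (evalAt (K n r s) z) = 0) : u = 0 := by
  ext ⟨a, i⟩
  refine congrFun (eq_zero_of_sum_mul_band_one (β := -(2 * z)) (γ := -(phi r 1).eval z)
    (fun a => u (a, i)) fun b => ?_) a
  rw [← vecMul_kronecker_one, ← evalAt_K, h, Pi.zero_apply]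

theorem eq_zero_of_vecMul_coeff_one_K (r : Kind) (s : ℕ) (u : Fin s × Fin n → ℂ)
    (h : Matrix.vecMul u ((K n r s).map (coeff · 1)) = 0) : u = 0 := by
  ext ⟨a, i⟩
  refine congrFun (eq_zero_of_sum_mul_band_zero (β := -2) (γ := -(phi r 1).coeff 1)
    (by norm_num) (neg_ne_zero.2 (coeff_phi_self_ne_zero r 1))
    (fun a => u (a, i)) fun b => ?_) a
  rw [← vecMul_kronecker_one, ← map_coeff_one_K, h, Pi.zero_apply]

theorem succ_block_eq_zero_of_coeff_one_K_mulVec (r : Kind) (s : ℕ)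
    (v : Fin (s + 1) × Fin n → ℂ) (h : ((K n r s).map (coeff · 1)).mulVec v = 0)
    (a : Fin s) (i : Fin n) : v (a.succ, i) = 0 := by
  refine eq_zero_of_sum_band_zero_mul (β := -2) (γ := -(phi r 1).coeff 1)
    (by norm_num) (neg_ne_zero.2 (coeff_phi_self_ne_zero r 1)) (fun b => v (b, i))
    (fun a => ?_) a
  rw [← kronecker_one_mulVec, ← map_coeff_one_K, h, Pi.zero_apply]

theorem coeff_one_K_apply_zero (r : Kind) (s : ℕ) (a : Fin s × Fin n) (j : Fin n) :
    (K n r s).map (coeff · 1) a (0, j) = 0 := by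
  rw [map_coeff_one_K, ← Prod.mk.eta (p := a), Matrix.kronecker_apply, band_zero_apply_zero,
    zero_mul]

end Kronecker

/-! ### The body between dual vectors equals the matrix polynomial. -/

section Identity

variable {n : ℕ}

theorem two_mul_phi_first (j : ℕ) :
    2 * phi Kind.first (j + 2) = phi Kind.second (j + 2) - phi Kind.second j := by
  simpa [phi] using Chebyshev.two_mul_T_eq_U_sub_U ℂ (j : ℤ)

/-- The block of index `(a, b)` of `body`. -/
noncomputable def bodyBlock (k : ℕ) (P : ℕ → Matrix (Fin n) (Fin n) ℂ) (ε : ℕ) (r : Kind)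
    (a b : ℕ) : Matrix (Fin n) (Fin n) ℂ[X] :=
  if ε = 0 then
    match r with
    | Kind.first => halfBlock k P a
    | Kind.second => stripBlock k P a
  else if ε = k - 1 then stripBlock k P b
  else hookBlock k P ε a b

theorem body_eq_ofBlocks (k : ℕ) (P : ℕ → Matrix (Fin n) (Fin n) ℂ) (ε : ℕ) (r : Kind) :
    body k P ε r = ofBlocks (bodyBlock k P ε r) := by
  ext x y
  cases r <;> simp only [body, ofBlocks, bodyBlock, Matrix.of_apply] <;> split_ifs <;> rfl

/-- One recurrence step on the top polynomial, `φ_{m+2} = 2λφ_{m+1} - φ_m`, absorbs the top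
coefficient into the next two. -/
theorem sum_phi_smul_stripBlock (r : Kind) (m : ℕ) (P : ℕ → Matrix (Fin n) (Fin n) ℂ) :
    ∑ b ∈ Finset.range (m + 2), phi r (m + 1 - b) • stripBlock (m + 2) P b =
      matPoly r (m + 2) P := by
  have h : ∀ b ∈ Finset.range m, phi r (m + 1 - (b + 1 + 1)) • stripBlock (m + 2) P (b + 1 + 1) =
      phi r (m - 1 - b) • const (P (m - 1 - b)) := by
    intro b hb
    rw [Finset.mem_range] at hb
    simp only [stripBlock, if_neg (show b + 1 + 1 ≠ 0 by omega),
      if_neg (show b + 1 + 1 ≠ 1 by omega)]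
    rw [show m + 1 - (b + 1 + 1) = m - 1 - b by omega,
      show m + 2 - 1 - (b + 1 + 1) = m - 1 - b by omega]
  rw [Finset.sum_range_succ', Finset.sum_range_succ', Finset.sum_congr rfl h,
    Finset.sum_range_reflect (fun j => phi r j • const (P j)), matPoly,
    Finset.sum_range_succ, Finset.sum_range_succ, Finset.sum_range_succ, phi_add_two r m]
  simp only [stripBlock, zero_add, if_true, one_ne_zero, if_false, Nat.add_sub_cancel,
    Nat.sub_zero, show m + 2 - 1 = m + 1 from rfl]
  module

theorem sum_phi_smul_stripBlock_second {k : ℕ} (hk : 1 ≤ k)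
    (P : ℕ → Matrix (Fin n) (Fin n) ℂ) :
    ∑ b ∈ Finset.range k, phi Kind.second (k - 1 - b) • stripBlock k P b =
      matPoly Kind.second k P := by
  obtain _ | _ | m := k
  · omega
  · simp [matPoly, stripBlock, Finset.sum_range_succ, phi_zero, phi_second_one, add_comm]
  · exact sum_phi_smul_stripBlock _ m P

/-- Change of basis by `2T_j = U_j - U_{j-2}` for `j ≥ 2`, with `2T_1 = U_1` and `T_0 = U_0`. The
last relation explains the doubled `P_0`; the term in `U_k` is then folded down by the recurrence.
-/
theorem sum_phi_smul_halfBlock {k : ℕ} (hk : 1 ≤ k) (P : ℕ → Matrix (Fin n) (Fin n) ℂ) :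
    ∑ b ∈ Finset.range k, phi Kind.second (k - 1 - b) • halfBlock k P b =
      matPoly Kind.first k P := by
  have hC : (C (1 / 2 : ℂ) : ℂ[X]) * 2 = 1 := by
    rw [← C_ofNat, ← C_mul]; norm_num
  have h1 : phi Kind.first 1 = X := by simp [phi]
  obtain _ | _ | m := k
  · omega
  · simp only [zero_add, Finset.range_one, Finset.sum_singleton, matPoly, halfBlock,
      Finset.sum_range_succ, Nat.sub_self, if_true, phi_zero, h1]
    rw [one_smul, one_smul, smul_add, smul_smul, smul_smul, ← mul_assoc, hC, one_mul, one_smul,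
      add_comm]
  -- The two summands of `halfBlock` are treated apart: this one carries the top coefficient and the
  -- `-U_{j-2}` parts, the next one the `U_j` parts.
  · have hfirst : ∑ b ∈ Finset.range (m + 2), phi Kind.second (m + 1 - b) •
        (if b = 0 then (2 * X : ℂ[X]) • const (P (m + 2))
        else if b = 1 then -((2 : ℂ[X]) • const (P (m + 2)))
        else -const (P (m + 2 + 1 - b))) =
        (phi Kind.second (m + 2) - phi Kind.second m) • const (P (m + 2)) -
          ∑ j ∈ Finset.range m, phi Kind.second j • const (P (j + 2)) := by
      have h : ∀ b ∈ Finset.range m, phi Kind.second (m + 1 - (b + 1 + 1)) •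
          (if b + 1 + 1 = 0 then (2 * X : ℂ[X]) • const (P (m + 2))
          else if b + 1 + 1 = 1 then -((2 : ℂ[X]) • const (P (m + 2)))
          else -const (P (m + 2 + 1 - (b + 1 + 1)))) =
          -(phi Kind.second (m - 1 - b) • const (P (m - 1 - b + 2))) := by
        intro b hb
        rw [Finset.mem_range] at hb
        rw [if_neg (by omega), if_neg (by omega),
          show m + 1 - (b + 1 + 1) = m - 1 - b by omega,
          show m + 2 + 1 - (b + 1 + 1) = m - 1 - b + 2 by omega, smul_neg]
      rw [Finset.sum_range_succ', Finset.sum_range_succ', Finset.sum_congr rfl h,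
        Finset.sum_neg_distrib,
        Finset.sum_range_reflect (fun j => phi Kind.second j • const (P (j + 2))),
        phi_add_two _ m]
      simp only [zero_add, if_true, one_ne_zero, if_false, Nat.add_sub_cancel, Nat.sub_zero]
      module
    have hsecond : ∑ b ∈ Finset.range (m + 2), phi Kind.second (m + 1 - b) •
        (if b = m + 1 then (2 : ℂ[X]) • const (P 0) else const (P (m + 1 - b))) =
        const (P 0) + ∑ j ∈ Finset.range (m + 2), phi Kind.second j • const (P j) := by
      rw [← Finset.sum_range_reflect, Finset.sum_range_succ' _ (m + 1),
        Finset.sum_range_succ' _ (m + 1)]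
      have h : ∀ b ∈ Finset.range (m + 1), phi Kind.second (m + 1 - (m + 2 - 1 - (b + 1))) •
          (if m + 2 - 1 - (b + 1) = m + 1 then (2 : ℂ[X]) • const (P 0)
          else const (P (m + 1 - (m + 2 - 1 - (b + 1))))) =
          phi Kind.second (b + 1) • const (P (b + 1)) := by
        intro b hb
        rw [Finset.mem_range] at hb
        rw [if_neg (by omega), show m + 1 - (m + 2 - 1 - (b + 1)) = b + 1 by omega]
      rw [Finset.sum_congr rfl h, if_pos (by omega),
        show m + 1 - (m + 2 - 1 - 0) = 0 by omega, phi_zero]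
      module
    have hdouble : ∀ j ∈ Finset.range m, phi Kind.first (j + 1 + 1) • const (P (j + 1 + 1)) =
        C (1 / 2 : ℂ) • (phi Kind.second (j + 1 + 1) • const (P (j + 1 + 1))) -
        C (1 / 2 : ℂ) • (phi Kind.second j • const (P (j + 2))) := by
      intro j _
      rw [← smul_sub, ← sub_smul, smul_smul, ← two_mul_phi_first, ← mul_assoc, hC, one_mul]
    simp only [halfBlock, show m + 1 + 1 = m + 2 from rfl, show m + 2 - 1 = m + 1 from rfl]
    simp only [smul_comm _ (C (1 / 2 : ℂ)), ← Finset.smul_sum, smul_add, Finset.sum_add_distrib]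
    rw [← smul_add, hfirst, hsecond, matPoly, Finset.sum_range_succ _ (m + 2),
      Finset.sum_range_succ' _ (m + 1), Finset.sum_range_succ' _ (m + 1),
      Finset.sum_range_succ' _ m, Finset.sum_range_succ' _ m,
      Finset.sum_congr rfl hdouble, Finset.sum_sub_distrib, ← Finset.smul_sum, ← Finset.smul_sum,
      ← two_mul_phi_first]
    simp only [zero_add, phi_zero, h1, phi_second_one]
    linear_combination (norm := module) (hC • (phi Kind.first (m + 2) • const (P (m + 2)) +
      (X : ℂ[X]) • const (P 1) + const (P 0)))

/-- By `phi_add`, the terms of index above `ε = e + 1` split into a multiple of `φ_ε`, supplied by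
the first block column, and one of `φ_{ε-1}`, supplied by the second. The terms of index below `ε`
come from the last block row. -/
theorem sum_phi_smul_hookBlock (r : Kind) (q e : ℕ) (P : ℕ → Matrix (Fin n) (Fin n) ℂ) :
    ∑ a ∈ Finset.range (q + 2), ∑ b ∈ Finset.range (e + 2),
      (phi Kind.second (q + 1 - a) * phi r (e + 1 - b)) • hookBlock (q + e + 3) P (e + 1) a b =
      matPoly r (q + e + 3) P := by
  -- Shifting by `ε` turns the first block column into a strip of grade `q + 2`, so the strip
  -- identity for `U` applies to it.
  set Q : ℕ → Matrix (Fin n) (Fin n) ℂ := fun i => P (i + (e + 1)) with hQ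
  have hstrip : ∀ a ∈ Finset.range (q + 2),
      stripBlock (q + e + 3) P a = stripBlock (q + 2) Q a := by
    intro a ha
    rw [Finset.mem_range] at ha
    simp only [stripBlock, hQ]
    rw [show q + 2 + (e + 1) = q + e + 3 by ring, show q + 2 - 1 + (e + 1) = q + e + 3 - 1 by omega,
      show q + 2 - 2 + (e + 1) = q + e + 3 - 2 by omega]
    split_ifs
    · rfl
    · rfl
    · rw [show q + 2 - 1 - a + (e + 1) = q + e + 3 - 1 - a by omega]
  have hrow : ∀ a ∈ Finset.range (q + 2), ∑ b ∈ Finset.range (e + 2),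
      (phi Kind.second (q + 1 - a) * phi r (e + 1 - b)) • hookBlock (q + e + 3) P (e + 1) a b =
      phi r (e + 1) • (phi Kind.second (q + 1 - a) • stripBlock (q + 2) Q a) -
      phi r e • (phi Kind.second (q + 1 - a) • const (Q (q + 1 - a + 1))) +
      if a = q + 1 then ∑ j ∈ Finset.range (e + 1), phi r j • const (P j) else 0 := by
    intro a ha
    rw [← hstrip a ha]
    rw [Finset.mem_range] at ha
    have hidx : q + e + 3 - 1 - (e + 1) = q + 1 := by omega
    have hP : Q (q + 1 - a + 1) = P (q + e + 3 - a) := by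
      simp only [hQ]; congr 1; omega
    rw [Finset.sum_range_succ', Finset.sum_range_succ', hP]
    simp only [hookBlock, hidx, Nat.add_eq_zero_iff, one_ne_zero, and_false, if_false, zero_add,
      if_true, Nat.add_eq_right, Nat.add_sub_cancel, Nat.sub_zero]
    split_ifs with h
    · subst h
      have htail : ∀ b ∈ Finset.range e,
          (phi Kind.second (q + 1 - (q + 1)) * phi r (e + 1 - (b + 1 + 1))) •
            const (P (e + 1 - (b + 1 + 1))) = phi r (e - 1 - b) • const (P (e - 1 - b)) := by
        intro b hb
        rw [Finset.mem_range] at hb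
        rw [show e + 1 - (b + 1 + 1) = e - 1 - b by omega, Nat.sub_self, phi_zero, one_mul]
      rw [Finset.sum_congr rfl htail, Finset.sum_range_reflect (fun j => phi r j • const (P j)),
        Finset.sum_range_succ, Nat.sub_self, phi_zero,
        show q + e + 3 - (q + 1) = e + 1 + 1 by omega]
      module
    · simp only [smul_zero, Finset.sum_const_zero]
      module
  have hdiag : ∑ a ∈ Finset.range (q + 2), phi Kind.second (q + 1 - a) • const (Q (q + 1 - a + 1)) =
      ∑ j ∈ Finset.range (q + 2), phi Kind.second j • const (Q (j + 1)) :=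
    Finset.sum_range_reflect (fun j => phi Kind.second j • const (Q (j + 1))) (q + 2)
  have hadd : ∀ j ∈ Finset.range (q + 2),
      phi r (e + 1 + (j + 1)) • const (P (e + 1 + (j + 1))) =
      phi r (e + 1) • (phi Kind.second (j + 1) • const (Q (j + 1))) -
      phi r e • (phi Kind.second j • const (Q (j + 1))) := by
    intro j _
    rw [phi_add, hQ, show e + 1 + (j + 1) = j + 1 + (e + 1) by ring]
    module
  rw [Finset.sum_congr rfl hrow, Finset.sum_add_distrib, Finset.sum_sub_distrib,
    ← Finset.smul_sum, ← Finset.smul_sum, sum_phi_smul_stripBlock, hdiag, Finset.sum_ite_eq',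
    if_pos (by simp), matPoly, matPoly, show q + e + 3 + 1 = (e + 1) + (q + 3) by ring,
    Finset.sum_range_add _ (e + 1) (q + 3), Finset.sum_range_succ' _ (q + 2), Finset.sum_range_succ' _ (q + 2),
    Finset.sum_congr rfl hadd, Finset.sum_sub_distrib, ← Finset.smul_sum, ← Finset.smul_sum,
    phi_zero]
  simp only [hQ, zero_add, add_zero]
  module

theorem sum_phi_smul_bodyBlock {k ε : ℕ} (hk : 1 ≤ k) (hε : ε ≤ k - 1) (r : Kind)
    (P : ℕ → Matrix (Fin n) (Fin n) ℂ) :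
    ∑ a ∈ Finset.range (k - 1 - ε + 1), ∑ b ∈ Finset.range (ε + 1),
      (phi Kind.second (k - 1 - ε - a) * phi r (ε - b)) • bodyBlock k P ε r a b =
      matPoly r k P := by
  rcases Nat.eq_zero_or_pos ε with rfl | hpos
  · rw [Nat.sub_zero, Nat.sub_add_cancel hk]
    cases r
    · simpa [bodyBlock, phi_zero] using sum_phi_smul_halfBlock hk P
    · simpa [bodyBlock, phi_zero] using sum_phi_smul_stripBlock_second hk P
  rcases hε.eq_or_lt with rfl | hlt
  · obtain ⟨m, rfl⟩ : ∃ m, k = m + 2 := ⟨k - 2, by omega⟩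
    simpa [bodyBlock, phi_zero] using sum_phi_smul_stripBlock r m P
  · obtain ⟨e, rfl⟩ : ∃ e, ε = e + 1 := ⟨ε - 1, by omega⟩
    obtain ⟨q, rfl⟩ : ∃ q, k = q + e + 3 := ⟨k - e - 3, by omega⟩
    have hq : q + e + 3 - 1 - (e + 1) = q + 1 := by omega
    simp only [bodyBlock, if_neg hpos.ne', if_neg hlt.ne, hq]
    exact sum_phi_smul_hookBlock r q e P

/-- The first block of the body has leading coefficient `2 P_k` or `P_k`. -/
theorem exists_coeff_one_bodyBlock (k : ℕ) (P : ℕ → Matrix (Fin n) (Fin n) ℂ) (ε : ℕ)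
    (r : Kind) : ∃ c : ℂ, c ≠ 0 ∧ (bodyBlock k P ε r 0 0).map (coeff · 1) = c • P k := by
  have hstrip : (stripBlock k P 0).map (coeff · 1) = (2 : ℂ) • P k := by
    ext i j
    simp [stripBlock, const, mul_assoc, coeff_ofNat_mul, coeff_C]
  have hhalf : (halfBlock k P 0).map (coeff · 1) = P k := by
    ext i j
    by_cases h : 0 = k - 1 <;>
    simp [halfBlock, const, mul_assoc, coeff_ofNat_mul, coeff_C, coeff_C_mul, h]
  unfold bodyBlock
  split_ifs
  · cases r
    · exact ⟨1, one_ne_zero, by simpa using hhalf⟩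
    · exact ⟨2, two_ne_zero, hstrip⟩
  · exact ⟨2, two_ne_zero, hstrip⟩
  · exact ⟨2, two_ne_zero, hstrip⟩

theorem map_coeff_matPoly (r : Kind) (k : ℕ) (P : ℕ → Matrix (Fin n) (Fin n) ℂ) :
    (matPoly r k P).map (coeff · k) = (phi r k).coeff k • P k := by
  ext i j
  simp only [matPoly, Matrix.map_apply, Matrix.sum_apply, Matrix.smul_apply, const,
    smul_eq_mul, finsetSum_coeff, coeff_mul_C]
  rw [Finset.sum_range_succ, Finset.sum_eq_zero, zero_add]
  intro m hm
  rw [coeff_eq_zero_of_natDegree_lt, zero_mul]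
  rw [natDegree_phi]
  exact Finset.mem_range.1 hm

end Identity

/-! ### Evaluation and coefficients of the linearization. -/

section Linearization

open Matrix

variable {n : ℕ}

theorem evalAt_const {α β : Type} (A : Matrix α β ℂ) (z : ℂ) :
    evalAt (const A) z = A := by
  ext; simp [evalAt, const]

theorem evalAt_add {α β : Type} (M N : Matrix α β ℂ[X]) (z : ℂ) :
    evalAt (M + N) z = evalAt M z + evalAt N z := by
  ext; simp [evalAt]

theorem evalAt_mul {α β γ : Type} [Fintype β] (M : Matrix α β ℂ[X]) (N : Matrix β γ ℂ[X])
    (z : ℂ) : evalAt (M * N) z = evalAt M z * evalAt N z := by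
  ext; simp [evalAt, Matrix.mul_apply, eval_finsetSum]

/-- This turns the eigenvalue at infinity into a kernel problem for coefficient matrices. -/
theorem evalAt_rev_zero {α β : Type} (g : ℕ) (M : Matrix α β ℂ[X]) :
    evalAt (rev g M) 0 = M.map (coeff · g) := by
  ext; simp [evalAt, rev, ← coeff_zero_eq_eval_zero, coeff_reflect]

theorem map_coeff_const_mul {α β γ : Type} [Fintype β] (A : Matrix α β ℂ) (N : Matrix β γ ℂ[X])
    (g : ℕ) : (const A * N).map (coeff · g) = A * N.map (coeff · g) := by
  ext; simp [const, Matrix.mul_apply, finsetSum_coeff, coeff_C_mul]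

theorem map_coeff_mul_const {α β γ : Type} [Fintype β] (M : Matrix α β ℂ[X]) (B : Matrix β γ ℂ)
    (g : ℕ) : (M * const B).map (coeff · g) = M.map (coeff · g) * B := by
  ext; simp [const, Matrix.mul_apply, finsetSum_coeff, coeff_mul_C]

theorem map_coeff_add {α β : Type} (M N : Matrix α β ℂ[X]) (g : ℕ) :
    (M + N).map (coeff · g) = M.map (coeff · g) + N.map (coeff · g) := by
  ext; simp

variable (k : ℕ) (P : ℕ → Matrix (Fin n) (Fin n) ℂ) (r : Kind) (ε : ℕ)
  (A : Matrix (Fin (k - 1 - ε + 1) × Fin n) (Fin ε × Fin n) ℂ)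
  (B : Matrix (Fin (k - 1 - ε) × Fin n) (Fin (ε + 1) × Fin n) ℂ)

theorem evalAt_chebLinearization (z : ℂ) :
    evalAt (chebLinearization k P r ε A B) z =
      Matrix.fromBlocks
        (evalAt (body k P ε r) z + A * evalAt (K n r ε) z +
          (evalAt (K n Kind.second (k - 1 - ε)) z)ᵀ * B)
        (evalAt (K n Kind.second (k - 1 - ε)) z)ᵀ (evalAt (K n r ε) z) 0 := by
  have hM : evalAt (body k P ε r + const A * K n r ε +
      (K n Kind.second (k - 1 - ε))ᵀ * const B) z =
      evalAt (body k P ε r) z + A * evalAt (K n r ε) z +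
        (evalAt (K n Kind.second (k - 1 - ε)) z)ᵀ * B := by
    rw [evalAt_add, evalAt_add, evalAt_mul, evalAt_mul, evalAt_const, evalAt_const]
    rfl
  rw [← hM, chebLinearization, evalAt, Matrix.fromBlocks_map]
  congr 1
  ext
  exact eval_zero

theorem map_coeff_one_chebLinearization :
    (chebLinearization k P r ε A B).map (coeff · 1) =
      Matrix.fromBlocks
        ((body k P ε r).map (coeff · 1) + A * (K n r ε).map (coeff · 1) +
          ((K n Kind.second (k - 1 - ε)).map (coeff · 1))ᵀ * B)
        ((K n Kind.second (k - 1 - ε)).map (coeff · 1))ᵀ ((K n r ε).map (coeff · 1)) 0 := by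
  rw [chebLinearization, Matrix.fromBlocks_map, map_coeff_add, map_coeff_add,
    map_coeff_const_mul, map_coeff_mul_const]
  congr 1

end Linearization

/-! ### Block elimination of `A` and `B`. -/

section BlockKernel

open Matrix

variable {m₁ m₂ q₁ q₂ : Type} [Fintype m₂] [Fintype q₂]

/-- The bottom row annihilates the `A` term, while the `B` term merges with the lower part of `z`.
The matrices are constant, so this serves both finite values and `λ`-coefficients. -/
theorem fromBlocks_mulVec_eq_zero [Fintype q₁] {M : Matrix m₁ q₁ ℂ} {A : Matrix m₁ m₂ ℂ}
    {B : Matrix q₂ q₁ ℂ} {K₁ : Matrix m₂ q₁ ℂ} {K₂ : Matrix q₂ m₁ ℂ} {z : q₁ ⊕ q₂ → ℂ}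
    (h : (Matrix.fromBlocks (M + A * K₁ + K₂ᵀ * B) K₂ᵀ K₁ 0) *ᵥ z = 0) :
    K₁ *ᵥ (z ∘ Sum.inl) = 0 ∧
      M *ᵥ (z ∘ Sum.inl) + (B *ᵥ (z ∘ Sum.inl) + z ∘ Sum.inr) ᵥ* K₂ = 0 := by
  rw [Matrix.fromBlocks_mulVec] at h
  have h₁ : K₁ *ᵥ (z ∘ Sum.inl) = 0 := by
    ext a
    simpa using congrFun h (Sum.inr a)
  refine ⟨h₁, ?_⟩
  ext a
  have := congrFun h (Sum.inl a)
  simp only [Sum.elim_inl, Matrix.add_mulVec, ← Matrix.mulVec_mulVec, h₁, Matrix.mulVec_zero,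
    add_zero, Matrix.mulVec_transpose] at this
  rw [Matrix.add_vecMul, ← add_assoc]
  exact this

theorem vecMul_fromBlocks_eq_zero [Fintype m₁] {M : Matrix m₁ q₁ ℂ} {A : Matrix m₁ m₂ ℂ}
    {B : Matrix q₂ q₁ ℂ} {K₁ : Matrix m₂ q₁ ℂ} {K₂ : Matrix q₂ m₁ ℂ} {w : m₁ ⊕ m₂ → ℂ}
    (h : w ᵥ* (Matrix.fromBlocks (M + A * K₁ + K₂ᵀ * B) K₂ᵀ K₁ 0) = 0) :
    K₂ *ᵥ (w ∘ Sum.inl) = 0 ∧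
      (w ∘ Sum.inl) ᵥ* M + ((w ∘ Sum.inl) ᵥ* A + w ∘ Sum.inr) ᵥ* K₁ = 0 := by
  rw [Matrix.vecMul_fromBlocks] at h
  have h₁ : K₂ *ᵥ (w ∘ Sum.inl) = 0 := by
    ext a
    simpa [Matrix.vecMul_transpose] using congrFun h (Sum.inr a)
  refine ⟨h₁, ?_⟩
  ext a
  have := congrFun h (Sum.inl a)
  simp only [Sum.elim_inl, Matrix.vecMul_add, ← Matrix.vecMul_vecMul, Matrix.vecMul_transpose, h₁,
    Matrix.zero_vecMul, add_zero] at this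
  rw [Matrix.add_vecMul, ← add_assoc]
  exact this

end BlockKernel

/-! ### Recovery of eigenvectors. -/

section Recovery

open Matrix

variable {n k ε : ℕ} {P : ℕ → Matrix (Fin n) (Fin n) ℂ} {r : Kind}
  {A : Matrix (Fin (k - 1 - ε + 1) × Fin n) (Fin ε × Fin n) ℂ}
  {B : Matrix (Fin (k - 1 - ε) × Fin n) (Fin (ε + 1) × Fin n) ℂ}
  {z : (Fin (ε + 1) × Fin n) ⊕ (Fin (k - 1 - ε) × Fin n) → ℂ}
  {w : (Fin (k - 1 - ε + 1) × Fin n) ⊕ (Fin ε × Fin n) → ℂ}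

/-- The evaluated body, squeezed between dual vectors, is the evaluated matrix polynomial. -/
theorem dualVec_dotProduct_body_mulVec (hk : 1 ≤ k) (hε : ε ≤ k - 1) (z₀ : ℂ)
    (x y : Fin n → ℂ) :
    dualVec Kind.second (k - 1 - ε) z₀ y ⬝ᵥ
      (evalAt (body k P ε r) z₀ *ᵥ dualVec r ε z₀ x) =
      y ⬝ᵥ (evalAt (matPoly r k P) z₀ *ᵥ x) := by
  have hentry : ∀ i j, eval z₀ (matPoly r k P i j) =
      ∑ a : Fin (k - 1 - ε + 1), ∑ b : Fin (ε + 1),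
        eval z₀ (phi Kind.second (k - 1 - ε - a)) * eval z₀ (phi r (ε - b)) *
          eval z₀ (bodyBlock k P ε r a b i j) := by
    intro i j
    rw [← sum_phi_smul_bodyBlock hk hε, Finset.sum_range]
    simp only [Finset.sum_range, Matrix.sum_apply, Matrix.smul_apply, smul_eq_mul,
      eval_finsetSum, eval_mul]
  simp only [dotProduct, mulVec, Fintype.sum_prod_type, evalAt, Matrix.map_apply, hentry,
    body_eq_ofBlocks, ofBlocks, Matrix.of_apply, dualVec, Finset.mul_sum, Finset.sum_mul]
  rw [Finset.sum_comm]
  refine Finset.sum_congr rfl fun i _ => ?_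
  symm
  rw [Finset.sum_comm]
  refine Finset.sum_congr rfl fun a _ => ?_
  rw [Finset.sum_comm]
  refine Finset.sum_congr rfl fun b _ => Finset.sum_congr rfl fun j _ => ?_
  ring

theorem isRightEigvec_blockEntry_last (hk : 1 ≤ k) (hε : ε ≤ k - 1) (z₀ : ℂ)
    (h : IsRightEigvec (chebLinearization k P r ε A B) z₀ z) :
    IsRightEigvec (matPoly r k P) z₀ (blockEntry z (Fin.last ε)) := by
  obtain ⟨hz, h⟩ := h
  rw [evalAt_chebLinearization] at h
  obtain ⟨h₁, h₂⟩ := fromBlocks_mulVec_eq_zero h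
  have hdual : z ∘ Sum.inl = dualVec r ε z₀ (blockEntry z (Fin.last ε)) :=
    eq_dualVec_of_evalAt_K_mulVec r ε z₀ _ h₁
  constructor
  · intro hx
    rw [hx, dualVec_zero] at hdual
    rw [hdual, mulVec_zero, mulVec_zero, zero_add, zero_add] at h₂
    have h₃ := eq_zero_of_vecMul_evalAt_K _ _ _ _ h₂
    exact hz (funext fun c => c.casesOn (congrFun hdual) (congrFun h₃))
  -- Testing against an arbitrary `y` lifts it to a dual vector of `K₂`, which annihilates the
  -- remaining term.
  · refine dotProduct_eq_zero_iff.1 fun y => ?_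
    rw [dotProduct_comm, ← dualVec_dotProduct_body_mulVec hk hε, ← hdual,
      eq_neg_of_add_eq_zero_left h₂, dotProduct_neg, dotProduct_comm, ← dotProduct_mulVec,
      evalAt_K_mulVec_dualVec, dotProduct_zero, neg_zero]

theorem isLeftEigvec_blockEntry_last (hk : 1 ≤ k) (hε : ε ≤ k - 1) (z₀ : ℂ)
    (h : IsLeftEigvec (chebLinearization k P r ε A B) z₀ w) :
    IsLeftEigvec (matPoly r k P) z₀ (blockEntry w (Fin.last (k - 1 - ε))) := by
  obtain ⟨hw, h⟩ := h
  rw [evalAt_chebLinearization] at h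
  obtain ⟨h₁, h₂⟩ := vecMul_fromBlocks_eq_zero h
  have hdual : w ∘ Sum.inl =
      dualVec Kind.second (k - 1 - ε) z₀ (blockEntry w (Fin.last (k - 1 - ε))) :=
    eq_dualVec_of_evalAt_K_mulVec _ _ z₀ _ h₁
  constructor
  · intro hx
    rw [hx, dualVec_zero] at hdual
    rw [hdual, zero_vecMul, zero_vecMul, zero_add, zero_add] at h₂
    have h₃ := eq_zero_of_vecMul_evalAt_K _ _ _ _ h₂
    exact hw (funext fun c => c.casesOn (congrFun hdual) (congrFun h₃))
  · refine dotProduct_eq_zero_iff.1 fun x => ?_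
    rw [← dotProduct_mulVec, ← dualVec_dotProduct_body_mulVec hk hε, ← hdual,
      dotProduct_mulVec, eq_neg_of_add_eq_zero_left h₂, neg_dotProduct, ← dotProduct_mulVec,
      evalAt_K_mulVec_dualVec, dotProduct_zero, neg_zero]

theorem isRightEigvecInf_blockEntry_zero
    (h : IsRightEigvecInf 1 (chebLinearization k P r ε A B) z) :
    IsRightEigvecInf k (matPoly r k P) (blockEntry z 0) := by
  obtain ⟨hz, h⟩ := h
  rw [evalAt_rev_zero, map_coeff_one_chebLinearization] at h
  obtain ⟨h₁, h₂⟩ := fromBlocks_mulVec_eq_zero h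
  have hsucc := succ_block_eq_zero_of_coeff_one_K_mulVec r ε _ h₁
  constructor
  · intro hx
    have hz₁ : z ∘ Sum.inl = 0 := by
      ext ⟨b, i⟩
      exact Fin.cases (congrFun hx i) (fun b => hsucc b i) b
    rw [hz₁, mulVec_zero, mulVec_zero, zero_add, zero_add] at h₂
    have h₃ := eq_zero_of_vecMul_coeff_one_K _ _ _ h₂
    exact hz (funext fun c => c.casesOn (congrFun hz₁) (congrFun h₃))
  · obtain ⟨c, hc, hlead⟩ := exists_coeff_one_bodyBlock k P ε r
    have hP : P k *ᵥ blockEntry z 0 = 0 := by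
      ext i
      have := congrFun h₂ (0, i)
      -- In the first block row the `K₂` term disappears, its `λ`-coefficient having zero first
      -- block column; only the corner block meets the surviving block of `z`.
      rw [Pi.add_apply, vecMul, dotProduct_comm, dotProduct,
        Finset.sum_eq_zero fun a _ => by rw [coeff_one_K_apply_zero, zero_mul], add_zero,
        mulVec, dotProduct, Fintype.sum_prod_type, Fin.sum_univ_succ] at this
      simp only [hsucc, mul_zero, Finset.sum_const_zero, add_zero] at this
      have hentry : ∀ j, (body k P ε r).map (coeff · 1) (0, i) (0, j) = c * P k i j := by
        intro j
        rw [body_eq_ofBlocks]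
        exact congrFun (congrFun hlead i) j
      simp only [hentry, mul_assoc, ← Finset.mul_sum] at this
      exact (mul_eq_zero.1 this).resolve_left hc
    rw [evalAt_rev_zero, map_coeff_matPoly, smul_mulVec, hP, smul_zero]

theorem isLeftEigvecInf_blockEntry_zero
    (h : IsLeftEigvecInf 1 (chebLinearization k P r ε A B) w) :
    IsLeftEigvecInf k (matPoly r k P) (blockEntry w 0) := by
  obtain ⟨hw, h⟩ := h
  rw [evalAt_rev_zero, map_coeff_one_chebLinearization] at h
  obtain ⟨h₁, h₂⟩ := vecMul_fromBlocks_eq_zero h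
  have hsucc := succ_block_eq_zero_of_coeff_one_K_mulVec _ _ _ h₁
  constructor
  · intro hx
    have hw₁ : w ∘ Sum.inl = 0 := by
      ext ⟨b, i⟩
      exact Fin.cases (congrFun hx i) (fun b => hsucc b i) b
    rw [hw₁, zero_vecMul, zero_vecMul, zero_add, zero_add] at h₂
    have h₃ := eq_zero_of_vecMul_coeff_one_K _ _ _ h₂
    exact hw (funext fun c => c.casesOn (congrFun hw₁) (congrFun h₃))
  · obtain ⟨c, hc, hlead⟩ := exists_coeff_one_bodyBlock k P ε r
    have hP : blockEntry w 0 ᵥ* P k = 0 := by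
      ext j
      have := congrFun h₂ (0, j)
      -- Here it is the first block column of the `λ`-coefficient of `K₁` that vanishes.
      rw [Pi.add_apply, vecMul, vecMul, dotProduct_comm (_ + _), dotProduct, dotProduct,
        Finset.sum_eq_zero (s := Finset.univ (α := Fin ε × Fin n))
          fun a _ => by rw [coeff_one_K_apply_zero, zero_mul], add_zero,
        Fintype.sum_prod_type, Fin.sum_univ_succ] at this
      simp only [hsucc, zero_mul, Finset.sum_const_zero, add_zero] at this
      have hentry : ∀ i, (body k P ε r).map (coeff · 1) (0, i) (0, j) = c * P k i j := by
        intro i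
        rw [body_eq_ofBlocks]
        exact congrFun (congrFun hlead i) j
      simp only [hentry, mul_left_comm _ c, ← Finset.mul_sum] at this
      exact (mul_eq_zero.1 this).resolve_left hc
    rw [evalAt_rev_zero, map_coeff_matPoly, vecMul_smul, hP, smul_zero]

end Recovery

end ChebLin

theorem mainTheorem10 (n k ε : ℕ) (hk : 1 ≤ k) (hε : ε ≤ k - 1) (r : ChebLin.Kind)
    (P : ℕ → Matrix (Fin n) (Fin n) ℂ)
    (hreg : ChebLin.IsRegular (ChebLin.matPoly r k P))
    (A : Matrix (Fin (k - 1 - ε + 1) × Fin n) (Fin ε × Fin n) ℂ)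
    (B : Matrix (Fin (k - 1 - ε) × Fin n) (Fin (ε + 1) × Fin n) ℂ)
    (z : (Fin (ε + 1) × Fin n) ⊕ (Fin (k - 1 - ε) × Fin n) → ℂ)
    (w : (Fin (k - 1 - ε + 1) × Fin n) ⊕ (Fin ε × Fin n) → ℂ) :
    -- finite eigenvalues: the blocks `z(ε+1)` and `w(k-ε)`
    (∀ z₀ : ℂ,
      (ChebLin.IsRightEigvec (ChebLin.chebLinearization k P r ε A B) z₀ z →
        ChebLin.IsRightEigvec (ChebLin.matPoly r k P) z₀
          (ChebLin.blockEntry z (Fin.last ε))) ∧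
      (ChebLin.IsLeftEigvec (ChebLin.chebLinearization k P r ε A B) z₀ w →
        ChebLin.IsLeftEigvec (ChebLin.matPoly r k P) z₀
          (ChebLin.blockEntry w (Fin.last (k - 1 - ε))))) ∧
    -- eigenvalue at infinity: the blocks `z(1)` and `w(1)`
    (ChebLin.IsRightEigvecInf 1 (ChebLin.chebLinearization k P r ε A B) z →
      ChebLin.IsRightEigvecInf k (ChebLin.matPoly r k P) (ChebLin.blockEntry z 0)) ∧
    (ChebLin.IsLeftEigvecInf 1 (ChebLin.chebLinearization k P r ε A B) w →
      ChebLin.IsLeftEigvecInf k (ChebLin.matPoly r k P) (ChebLin.blockEntry w 0)) :=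
  ⟨fun z₀ => ⟨ChebLin.isRightEigvec_blockEntry_last hk hε z₀,
      ChebLin.isLeftEigvec_blockEntry_last hk hε z₀⟩,
    ChebLin.isRightEigvecInf_blockEntry_zero, ChebLin.isLeftEigvecInf_blockEntry_zero⟩
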